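/- Let $m\ge 2$ be an integer. For $\pi_0\in[0,1]$, $\rho\in[0,1]$ and $\mu>0$, let $(H,\mathbf p)$ follow the unconditional equicorrelated multivariate normal (EMN) model $\overline P^N_{(\pi_0,\rho,\mu)}$: the coordinates of $H=(H_i)_{1\le i\le m}\in\{0,1\}^m$ are i.i.d. Bernoulli with parameter $1-\pi_0$ and, conditionally on $H$, $p_i=\overline\Phi(X_i+\mu H_i)$ for $1\le i\le m$, where $(X_i)_{1\le i\le m}$ is a centred Gaussian vector whose covariance matrix has $1$ on the diagonal and $\rho$ elsewhere, and $\overline\Phi(z)=\mathbb P(Z\ge z)$ for $Z\sim\mathcal N(0,1)$. The $i$-th null hypothesis is true if and only if $H_i=0$. A threshold is a nondecreasing sequence $\mathbf t=(t_k)_{1\le k\le m}\in[0,1]^m$. Let $p_{(1)}\le\dots\le p_{(m)}$ be the ordered $p$-values, and put $t_0=p_{(0)}=0$. The step-up procedure $\mathrm{SU}(\mathbf t)$ rejects the set of all $i$ with $p_i\le t_{\hat k}$, where $\hat k=\max\{k\in\{0,\dots,m\}: p_{(k)}\le t_k\}$; the step-down procedure $\mathrm{SD}(\mathbf t)$ rejects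 the set of all $i$ with $p_i\le t_{\tilde k}$, where $\tilde k=\max\{k\in\{0,\dots,m\}: p_{(k')}\le t_{k'} \text{ for all } k'\le k\}$. For $\alpha\in[0,1]$, $\mathrm{LSU}$ denotes $\mathrm{SU}(\mathbf t)$ with $t_k=\alpha k/m$. For a procedure $R$ rejecting the set $R(\mathbf p)\subset\{1,\dots,m\}$, let $$\mathrm{FDR}\big(R,\overline P^N_{(\pi_0,\rho,\mu)}\big)=\mathbb E_{(H,\mathbf p)\sim\overline P^N_{(\pi_0,\rho,\mu)}}\left[\frac{|\{i\in R(\mathbf p): H_i=0\}|}{\max(|R(\mathbf p)|,1)}\right].$$ Then, for every threshold $\mathbf t$, the functions $$(\pi_0,\rho,\mu)\mapsto \mathrm{FDR}\big(\mathrm{SU}(\mathbf t),\overline P^N_{(\pi_0,\rho,\mu)}\big)\quad\text{and}\quad(\pi_0,\rho,\mu)\mapsto \mathrm{FDR}\big(\mathrm{SD}(\mathbf t),\overline P^N_{(\pi_0,\rho,\mu)}\big)$$ are (jointly) continuous on $[0,1]\times[0,1]\times(0,\infty)$, including at the points with $\rho=1$. Moreover, for every $\alpha\in[0,1]$ and every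 $\mu>0$, $$\lim_{\rho\to0^+}\mathrm{FDR}\big(\mathrm{LSU},\overline P^N_{(1,\rho,\mu)}\big)=\alpha.$$ -/

import Mathlib

open MeasureTheory ProbabilityTheory Filter Topology unitInterval

noncomputable section

namespace FDRContinuity

/-! ### The p-value models -/

/-- The upper tail `z ↦ P(Z ≥ z)` of the standard Gaussian distribution. -/
def gaussianTail (z : ℝ) : ℝ := (gaussianReal 0 1).real (Set.Ici z)

/-- The `m × m` matrix with `1` on the diagonal and `ρ` elsewhere. -/
def equicorrMatrix (m : ℕ) (ρ : ℝ) : Matrix (Fin m) (Fin m) ℝ :=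
  Matrix.of fun i j => if i = j then 1 else ρ

/-- The conditional equicorrelated multivariate normal (EMN) model: the law of the family of
p-values `p i = gaussianTail (X i + μ * H i)`, where `X` is a centred Gaussian vector with
covariance matrix `equicorrMatrix m ρ`. The `i`-th null hypothesis is true iff `H i = 0`. -/
def condEMN {m : ℕ} (H : Fin m → Fin 2) (ρ μ : ℝ) : Measure (Fin m → ℝ) :=
  (multivariateGaussian 0 (equicorrMatrix m ρ)).map
    fun X i => gaussianTail (X i + μ * ((H i : ℕ) : ℝ))

/-- The prior on `H`: the `H i` are i.i.d. Bernoulli with parameter `1 - π₀`. -/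
def prior (m : ℕ) (π₀ : unitInterval) : Measure (Fin m → Fin 2) :=
  Measure.pi fun _ => bernoulliMeasure (1 : Fin 2) (0 : Fin 2) (σ π₀)

/-- The conditional EMN model as a Markov kernel from `H` to the p-value family. -/
def condEMNKernel (m : ℕ) (ρ μ : ℝ) : Kernel (Fin m → Fin 2) (Fin m → ℝ) :=
  Kernel.ofFunOfCountable fun H => condEMN H ρ μ

theorem measurable_gaussianTail : Measurable gaussianTail := by
  have h : Antitone gaussianTail := fun a b hab =>
    measureReal_mono (Set.Ici_subset_Ici.2 hab)
  exact h.measurable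

instance isProbabilityMeasure_condEMN {m : ℕ} (H : Fin m → Fin 2) (ρ μ : ℝ) : IsProbabilityMeasure (condEMN H ρ μ) := by
  unfold condEMN
  refine Measure.isProbabilityMeasure_map (Measurable.aemeasurable ?_)
  refine measurable_pi_lambda _ fun i => measurable_gaussianTail.comp ?_
  fun_prop

instance isMarkovKernel_condEMNKernel (m : ℕ) (ρ μ : ℝ) : IsMarkovKernel (condEMNKernel m ρ μ) :=
  ⟨fun H => inferInstanceAs (IsProbabilityMeasure (condEMN H ρ μ))⟩

/-- The unconditional EMN model: the law of `(H, p)` where `H` follows the prior and, conditionally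
on `H`, the p-value family `p` follows the conditional EMN model. -/
def uncondEMN (m : ℕ) (π₀ : unitInterval) (ρ μ : ℝ) :
    Measure ((Fin m → Fin 2) × (Fin m → ℝ)) :=
  (prior m π₀).compProd (condEMNKernel m ρ μ)

/-! ### Step-up and step-down procedures

A threshold `t₁ ≤ ⋯ ≤ tₘ` is a function `t : Fin m → ℝ`, where `t k` stands for `t_{k+1}`. -/

/-- A threshold is a nondecreasing sequence in `[0, 1]`. -/
structure IsThreshold {m : ℕ} (t : Fin m → ℝ) : Prop where
  mono : Monotone t
  mem : ∀ k, t k ∈ Set.Icc (0 : ℝ) 1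

/-- The threshold values `t₀, t₁, …, tₘ`, with the convention `t₀ = 0`. -/
def thr {m : ℕ} (t : Fin m → ℝ) : Fin (m + 1) → ℝ := Fin.cons 0 t

/-- The ordered p-values `p₍₀₎, p₍₁₎ ≤ ⋯ ≤ p₍ₘ₎`, with the convention `p₍₀₎ = 0`. -/
def ordered {m : ℕ} (p : Fin m → ℝ) : Fin (m + 1) → ℝ := Fin.cons 0 (p ∘ Tuple.sort p)

/-- `max {k ∈ {0, …, m} | p₍ₖ₎ ≤ tₖ}`. -/
def stepUpIndex {m : ℕ} (t p : Fin m → ℝ) : Fin (m + 1) :=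
  (Finset.univ.filter fun k : Fin (m + 1) => ordered p k ≤ thr t k).max'
    ⟨0, Finset.mem_filter.2 ⟨Finset.mem_univ _, le_refl (0 : ℝ)⟩⟩

open Classical in
/-- `max {k ∈ {0, …, m} | p₍ₖ'₎ ≤ tₖ' for all k' ≤ k}`. -/
def stepDownIndex {m : ℕ} (t p : Fin m → ℝ) : Fin (m + 1) :=
  (Finset.univ.filter fun k : Fin (m + 1) => ∀ k' ≤ k, ordered p k' ≤ thr t k').max'
    ⟨0, Finset.mem_filter.2 ⟨Finset.mem_univ _, fun k' hk' => by
      rw [Fin.le_zero_iff.1 hk']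
      exact le_refl (0 : ℝ)⟩⟩

/-- The set of hypotheses rejected by the step-up procedure of threshold `t`. -/
def SU {m : ℕ} (t p : Fin m → ℝ) : Finset (Fin m) :=
  Finset.univ.filter fun i => p i ≤ thr t (stepUpIndex t p)

/-- The set of hypotheses rejected by the step-down procedure of threshold `t`. -/
def SD {m : ℕ} (t p : Fin m → ℝ) : Finset (Fin m) :=
  Finset.univ.filter fun i => p i ≤ thr t (stepDownIndex t p)

/-- The linear threshold `t_k = α k / m`, `1 ≤ k ≤ m`. -/
def linearThreshold (m : ℕ) (α : ℝ) : Fin m → ℝ := fun k => α * ((k : ℕ) + 1) / m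

/-- The linear step-up procedure. -/
def LSU {m : ℕ} (α : ℝ) (p : Fin m → ℝ) : Finset (Fin m) := SU (linearThreshold m α) p

/-! ### The false discovery rate -/

/-- The false discovery proportion `|ℋ₀(H) ∩ R| / (|R| ∨ 1)`. -/
def FDP {m : ℕ} (R : Finset (Fin m)) (H : Fin m → Fin 2) : ℝ :=
  (((Finset.univ.filter fun i => H i = 0) ∩ R).card : ℝ) / max (R.card : ℝ) 1

/-- The false discovery rate of the procedure `R` when `(H, p)` has law `P`. -/
def FDR {m : ℕ} (R : (Fin m → ℝ) → Finset (Fin m))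
    (P : Measure ((Fin m → Fin 2) × (Fin m → ℝ))) : ℝ :=
  ∫ x, FDP (R x.2) x.1 ∂P

end FDRContinuity

end

noncomputable section

namespace FDRContinuity

/-! ### Step-wise procedures in terms of rejection counts -/

variable {m : ℕ}

/-! For ρ in [0, 1] the Gaussian vector is `equicorrSqrt m ρ` applied to i.i.d. standard normals,
and the entries of this root are continuous up to ρ = 1. All the conditional models thus live on one
probability space, with p-values jointly continuous in (ρ, μ, x) (`condEMN_eq_map`,
`continuous_emnPValues`). A step-wise procedure sees the p-values only through their comparisons
with the thresholds, so its FDP is locally constant wherever no p-value equals a threshold. Each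
coordinate has variance 1 for every ρ, so ties are null even at ρ = 1 (`ae_emnPValues_ne`).
Dominated convergence then gives continuity given H, and averaging over H only adds weights
polynomial in π₀.

By continuity, the limit of the LSU is its value at ρ = 0, π₀ = 1: independent uniform p-values, all
nulls true. There the leave-one-out identity `ite_stepUpIndex_eq_update` makes each hypothesis
contribute exactly α / m. -/

theorem ordered_le_thr_iff (t p : Fin m → ℝ) (k : Fin (m + 1)) :
    ordered p k ≤ thr t k ↔ (k : ℕ) ≤ (Finset.univ.filter fun i => p i ≤ thr t k).card := by
  refine Fin.cases ?_ (fun j => ?_) k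
  · simp [ordered, thr]
  · have h := Tuple.lt_card_le_iff_apply_le_of_monotone (f := p ∘ Tuple.sort p) (j := j)
      (a := thr t j.succ) (Tuple.monotone_sort p)
    have hc : (Finset.univ.filter fun i => p (Tuple.sort p i) ≤ thr t j.succ).card
        = (Finset.univ.filter fun i => p i ≤ thr t j.succ).card := by
      refine Finset.card_bij (fun i _ => Tuple.sort p i) (by simp) (by simp) fun b hb => ?_
      exact ⟨(Tuple.sort p).symm b, by simpa using hb, by simp⟩
    simp only [Function.comp_apply] at h
    rw [hc] at h
    rw [Fin.val_succ, Nat.succ_le_iff, h]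
    simp [ordered]

/-- A procedure is determined by the comparisons of the p-values with the thresholds if it takes
the same value at two p-value families comparing in the same way with each `t₀, …, tₘ`. -/
def DeterminedByThr {β : Type*} (t : Fin m → ℝ) (R : (Fin m → ℝ) → β) : Prop :=
  ∀ p q : Fin m → ℝ, (∀ i k, p i ≤ thr t k ↔ q i ≤ thr t k) → R p = R q

theorem determinedByThr_stepUpIndex (t : Fin m → ℝ) : DeterminedByThr t (stepUpIndex t) := by
  intro p q h
  unfold stepUpIndex
  congr 1
  ext k
  simp only [ordered_le_thr_iff, h]

theorem determinedByThr_SU (t : Fin m → ℝ) : DeterminedByThr t (SU t) := by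
  intro p q h
  simp only [SU, determinedByThr_stepUpIndex t p q h, h]

theorem determinedByThr_SD (t : Fin m → ℝ) : DeterminedByThr t (SD t) := by
  intro p q h
  have hk : stepDownIndex t p = stepDownIndex t q := by
    unfold stepDownIndex
    congr 1
    ext k
    simp only [ordered_le_thr_iff, h]
  simp only [SD, hk, h]

theorem DeterminedByThr.comp {β γ : Type*} {t : Fin m → ℝ} {R : (Fin m → ℝ) → β}
    (hR : DeterminedByThr t R) (g : β → γ) : DeterminedByThr t fun p => g (R p) :=
  fun p q h => congrArg g (hR p q h)

/-- Such an `f` factors through the measurable map to comparison patterns, which form a finite type.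
-/
theorem DeterminedByThr.measurable {t : Fin m → ℝ} {f : (Fin m → ℝ) → ℝ}
    (hf : DeterminedByThr t f) : Measurable f := by
  let c : (Fin m → ℝ) → Fin m → Fin (m + 1) → Prop := fun p i k => p i ≤ thr t k
  have hc : Measurable c := by
    refine measurable_pi_lambda _ fun i => measurable_pi_lambda _ fun k => ?_
    exact measurableSet_setOfPred.1 (measurableSet_le (measurable_pi_apply i) measurable_const)
  have hfac : Function.FactorsThrough f c := fun p q hpq =>
    hf p q fun i k => iff_of_eq (congrFun (congrFun hpq i) k)
  have : f = Function.extend c f 0 ∘ c := by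
    ext p
    exact (hfac.extend_apply 0 p).symm
  rw [this]
  exact (measurable_of_finite _).comp hc

theorem DeterminedByThr.eventuallyEq {β : Type*} {t : Fin m → ℝ} {R : (Fin m → ℝ) → β}
    (hR : DeterminedByThr t R) {p : Fin m → ℝ} (hp : ∀ i k, p i ≠ thr t k) :
    ∀ᶠ q in 𝓝 p, R q = R p := by
  have : ∀ᶠ q in 𝓝 p, ∀ i k, (q i ≤ thr t k ↔ p i ≤ thr t k) := by
    refine eventually_all.2 fun i => eventually_all.2 fun k => ?_
    have hi : Tendsto (fun q : Fin m → ℝ => q i) (𝓝 p) (𝓝 (p i)) :=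
      (continuous_apply i).continuousAt
    rcases lt_or_gt_of_ne (hp i k) with h | h
    · filter_upwards [hi.eventually_lt_const h] with q hq
      simp [hq.le, h.le]
    · filter_upwards [hi.eventually_const_lt h] with q hq
      simp [hq.not_ge, h.not_ge]
  filter_upwards [this] with q hq using hR q p hq

theorem FDP_nonneg (R : Finset (Fin m)) (H : Fin m → Fin 2) : 0 ≤ FDP R H := by
  unfold FDP; positivity

theorem FDP_le_one (R : Finset (Fin m)) (H : Fin m → Fin 2) : FDP R H ≤ 1 := by
  unfold FDP
  refine div_le_one_of_le₀ (le_max_of_le_left ?_) (by positivity)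
  exact_mod_cast Finset.card_le_card Finset.inter_subset_right

theorem norm_FDP_le_one (R : Finset (Fin m)) (H : Fin m → Fin 2) : ‖FDP R H‖ ≤ 1 := by
  rw [Real.norm_of_nonneg (FDP_nonneg R H)]
  exact FDP_le_one R H

/-! ### The Gaussian tail -/

theorem gaussianTail_strictAnti : StrictAnti gaussianTail := by
  intro a b hab
  have hu : Set.Ico a b ∪ Set.Ici b = Set.Ici a := Set.Ico_union_Ici_eq_Ici hab.le
  have hd : Disjoint (Set.Ico a b) (Set.Ici b) :=
    Set.disjoint_left.2 fun x hx hx' => (not_le.2 hx.2) hx'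
  have h := measureReal_union (μ := gaussianReal 0 1) hd measurableSet_Ici
  rw [hu] at h
  have hpos : 0 < (gaussianReal 0 1).real (Set.Ico a b) := by
    refine ENNReal.toReal_pos (fun h0 => ?_) (measure_ne_top _ _)
    have := gaussianReal_absolutelyContinuous' 0 one_ne_zero h0
    simp only [Real.volume_Ico, ENNReal.ofReal_eq_zero] at this
    linarith
  unfold gaussianTail
  linarith

theorem gaussianTail_eq_one_sub_cdf (z : ℝ) : gaussianTail z = 1 - cdf (gaussianReal 0 1) z := by
  have := nullSingletonClass_gaussianReal (μ := 0) (one_ne_zero (α := NNReal))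
  rw [ProbabilityTheory.cdf_eq_real, gaussianTail, ← probReal_compl_eq_one_sub measurableSet_Iic, Set.compl_Iic]
  exact measureReal_congr Ioi_ae_eq_Ici.symm

theorem continuous_gaussianTail : Continuous gaussianTail := by
  have := nullSingletonClass_gaussianReal (μ := 0) (one_ne_zero (α := NNReal))
  have hc : Continuous (cdf (gaussianReal 0 1)) := by
    refine continuous_iff_continuousAt.2 fun x => ?_
    have h0 : (cdf (gaussianReal 0 1)).measure {x} = 0 := by
      rw [measure_cdf]; exact measure_singleton x
    rw [StieltjesFunction.measure_singleton, ENNReal.ofReal_eq_zero, sub_nonpos] at h0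
    have hl := le_antisymm ((monotone_cdf (gaussianReal 0 1)).leftLim_le le_rfl) h0
    exact continuousAt_iff_continuous_left'_right'.2
      ⟨(monotone_cdf _).continuousWithinAt_Iio_iff_leftLim_eq.2 hl,
        ((cdf (gaussianReal 0 1)).right_continuous x).mono Set.Ioi_subset_Ici_self⟩
  simp_rw [funext gaussianTail_eq_one_sub_cdf]
  fun_prop

theorem gaussianTail_pos (z : ℝ) : 0 < gaussianTail z :=
  lt_of_le_of_lt measureReal_nonneg (gaussianTail_strictAnti (lt_add_one z))

theorem gaussianTail_lt_one (z : ℝ) : gaussianTail z < 1 :=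
  lt_of_lt_of_le (gaussianTail_strictAnti (sub_one_lt z)) measureReal_le_one

/-- Null p-values are uniform: the tail is continuous with limits 1 and 0, so every level strictly
between is attained. -/
theorem measureReal_gaussianTail_le {s : ℝ} (h0 : 0 ≤ s) (h1 : s ≤ 1) :
    (gaussianReal 0 1).real {x | gaussianTail x ≤ s} = s := by
  rcases h0.eq_or_lt with rfl | h0
  · have : {x | gaussianTail x ≤ 0} = ∅ := by
      ext x; simp [gaussianTail_pos x]
    simp [this]
  rcases h1.eq_or_lt with rfl | h1
  · have : {x | gaussianTail x ≤ 1} = Set.univ := by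
      ext x; simp [(gaussianTail_lt_one x).le]
    simp [this]
  obtain ⟨z, rfl⟩ : ∃ z, gaussianTail z = s := by
    have hbot : Tendsto gaussianTail atBot (𝓝 1) := by
      rw [funext gaussianTail_eq_one_sub_cdf]
      simpa using (tendsto_cdf_atBot (gaussianReal 0 1)).const_sub 1
    have htop : Tendsto gaussianTail atTop (𝓝 0) := by
      rw [funext gaussianTail_eq_one_sub_cdf]
      simpa using (tendsto_cdf_atTop (gaussianReal 0 1)).const_sub 1
    obtain ⟨a, ha⟩ := (htop.eventually_lt_const h0).exists
    obtain ⟨b, hb⟩ := (hbot.eventually_const_lt h1).exists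
    exact mem_range_of_exists_le_of_exists_ge continuous_gaussianTail ⟨a, ha.le⟩ ⟨b, hb.le⟩
  have : {x | gaussianTail x ≤ gaussianTail z} = Set.Ici z := by
    ext x; simp [gaussianTail_strictAnti.le_iff_ge]
  rw [this]
  rfl

/-! ### The equicorrelated Gaussian vector as a function of independent Gaussian variables -/

/-- The law of `m` independent standard Gaussian variables. -/
def stdGaussianPi (m : ℕ) : Measure (Fin m → ℝ) := Measure.pi fun _ => gaussianReal 0 1

instance (m : ℕ) : IsProbabilityMeasure (stdGaussianPi m) := by
  unfold stdGaussianPi; infer_instance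

/-- The off-diagonal coefficient of the square root of `equicorrMatrix m ρ`. -/
def equicorrCoeff (m : ℕ) (ρ : ℝ) : ℝ := (√(1 + (m - 1) * ρ) - √(1 - ρ)) / m

/-- The square root of `equicorrMatrix m ρ`. -/
def equicorrSqrt (m : ℕ) (ρ : ℝ) : Matrix (Fin m) (Fin m) ℝ :=
  √(1 - ρ) • (1 : Matrix (Fin m) (Fin m) ℝ) + equicorrCoeff m ρ • Matrix.of fun _ _ => (1 : ℝ)

/-- With J the all-ones matrix, J² = mJ gives (aI + cJ)² = a²I + (2ac + mc²)J. The coefficient c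
makes a + mc = √(1 + (m - 1)ρ), the eigenvalue of the root on constant vectors. -/
theorem equicorrSqrt_mul_self (hm : 0 < m) {ρ : ℝ} (h0 : 0 ≤ ρ) (h1 : ρ ≤ 1) :
    equicorrSqrt m ρ * equicorrSqrt m ρ = equicorrMatrix m ρ := by
  have hm' : (m : ℝ) ≠ 0 := by positivity
  have hm1 : (1 : ℝ) ≤ m := by exact_mod_cast hm
  have ha : √(1 - ρ) ^ 2 = 1 - ρ := Real.sq_sqrt (by linarith)
  have hb : √(1 + (m - 1) * ρ) ^ 2 = 1 + (m - 1) * ρ :=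
    Real.sq_sqrt (by have := mul_nonneg (sub_nonneg.2 hm1) h0; linarith)
  have hJ : (Matrix.of fun _ _ => (1 : ℝ) : Matrix (Fin m) (Fin m) ℝ) *
      (Matrix.of fun _ _ => (1 : ℝ)) = (m : ℝ) • Matrix.of fun _ _ => (1 : ℝ) := by
    ext i j; simp [Matrix.mul_apply]
  have hab : 2 * √(1 - ρ) * equicorrCoeff m ρ + m * equicorrCoeff m ρ ^ 2 = ρ := by
    unfold equicorrCoeff
    generalize √(1 + (m - 1) * ρ) = b at hb ⊢
    field_simp
    linear_combination hb - ha
  unfold equicorrSqrt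
  rw [add_mul, mul_add, mul_add]
  simp only [smul_mul_assoc, mul_smul_comm, one_mul, mul_one, hJ]
  ext i j
  by_cases hij : i = j
  · simp [equicorrMatrix, hij]
    linear_combination ha + hab
  · simp [equicorrMatrix, hij]
    linear_combination hab

theorem equicorrCoeff_nonneg {ρ : ℝ} (h0 : 0 ≤ ρ) : 0 ≤ equicorrCoeff m ρ := by
  refine div_nonneg (sub_nonneg.2 (Real.sqrt_le_sqrt ?_)) (Nat.cast_nonneg m)
  have : (0 : ℝ) ≤ m * ρ := by positivity
  linarith

theorem posSemidef_equicorrSqrt {ρ : ℝ} (h0 : 0 ≤ ρ) : (equicorrSqrt m ρ).PosSemidef := by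
  have hJ : (Matrix.of fun _ _ => (1 : ℝ) : Matrix (Fin m) (Fin m) ℝ).PosSemidef := by
    have := Matrix.posSemidef_vecMulVec_self_star (fun _ : Fin m => (1 : ℝ))
    convert this using 1
    ext i j; simp [Matrix.vecMulVec_apply]
  exact (Matrix.PosSemidef.one.smul (Real.sqrt_nonneg _)).add (hJ.smul (equicorrCoeff_nonneg h0))

theorem posSemidef_equicorrMatrix (hm : 0 < m) {ρ : ℝ} (h0 : 0 ≤ ρ) (h1 : ρ ≤ 1) :
    (equicorrMatrix m ρ).PosSemidef := by
  have h := Matrix.posSemidef_conjTranspose_mul_self (equicorrSqrt m ρ)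
  rwa [(posSemidef_equicorrSqrt h0).isHermitian.eq, equicorrSqrt_mul_self hm h0 h1] at h

open scoped MatrixOrder in
-- Uniqueness of the positive semidefinite root identifies the abstract root in
-- `multivariateGaussian` with an explicit matrix.
theorem sqrt_equicorrMatrix (hm : 0 < m) {ρ : ℝ} (h0 : 0 ≤ ρ) (h1 : ρ ≤ 1) :
    CFC.sqrt (equicorrMatrix m ρ) = equicorrSqrt m ρ :=
  CFC.sqrt_unique (equicorrSqrt_mul_self hm h0 h1) (posSemidef_equicorrSqrt h0).nonneg

/-- The p-values of the conditional EMN model as a function of independent Gaussian variables. -/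
def emnPValues (H : Fin m → Fin 2) (ρ μ : ℝ) (x : Fin m → ℝ) : Fin m → ℝ := fun i =>
  gaussianTail (√(1 - ρ) * x i + equicorrCoeff m ρ * ∑ j, x j + μ * ((H i : ℕ) : ℝ))

theorem continuous_emnPValues (H : Fin m → Fin 2) :
    Continuous fun y : ℝ × ℝ × (Fin m → ℝ) => emnPValues H y.1 y.2.1 y.2.2 := by
  unfold emnPValues equicorrCoeff
  refine continuous_pi fun i => continuous_gaussianTail.comp ?_
  fun_prop

theorem measurable_emnPValues (H : Fin m → Fin 2) (ρ μ : ℝ) : Measurable (emnPValues H ρ μ) :=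
  ((continuous_emnPValues H).comp (by fun_prop :
    Continuous fun x : Fin m → ℝ => (ρ, μ, x))).measurable

theorem measurable_pValues (H : Fin m → Fin 2) (μ : ℝ) :
    Measurable fun (X : EuclideanSpace ℝ (Fin m)) i => gaussianTail (X i + μ * ((H i : ℕ) : ℝ)) :=
  measurable_pi_lambda _ fun i => measurable_gaussianTail.comp (by fun_prop)

theorem condEMN_eq_map (hm : 0 < m) (H : Fin m → Fin 2) {ρ : ℝ} (h0 : 0 ≤ ρ) (h1 : ρ ≤ 1)
    (μ : ℝ) : condEMN H ρ μ = (stdGaussianPi m).map (emnPValues H ρ μ) := by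
  rw [condEMN, multivariateGaussian, sqrt_equicorrMatrix hm h0 h1, ← map_pi_eq_stdGaussian,
    Measure.map_map (measurable_pValues H μ) (by fun_prop),
    Measure.map_map ((measurable_pValues H μ).comp (by fun_prop)) (by fun_prop), stdGaussianPi]
  congr 1
  ext x i
  simp [emnPValues, equicorrSqrt, Matrix.mulVec, dotProduct, Finset.mul_sum]

theorem ae_emnPValues_ne (hm : 0 < m) (H : Fin m → Fin 2) {ρ : ℝ} (h0 : 0 ≤ ρ) (h1 : ρ ≤ 1)
    (μ : ℝ) (i : Fin m) (s : ℝ) : ∀ᵐ x ∂stdGaussianPi m, emnPValues H ρ μ x i ≠ s := by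
  have hset : MeasurableSet {p : Fin m → ℝ | p i ≠ s} :=
    (measurableSet_eq_fun (measurable_pi_apply i) measurable_const).compl
  have hP : ∀ᵐ p ∂condEMN H ρ μ, p i ≠ s := by
    rw [condEMN, ae_map_iff (measurable_pValues H μ).aemeasurable hset]
    have hmp := measurePreserving_eval_multivariateGaussian (μ := 0)
      (posSemidef_equicorrMatrix hm h0 h1) (i := i)
    have hv : (equicorrMatrix m ρ i i).toNNReal ≠ 0 := by simp [equicorrMatrix]
    have := nullSingletonClass_gaussianReal (μ := 0) hv
    -- Strict monotonicity of the tail leaves at most one Gaussian value for each p-value, hence a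
    -- null set.
    have hsub : {x : ℝ | gaussianTail (x + μ * ((H i : ℕ) : ℝ)) = s}.Subsingleton := by
      intro x hx y hy
      have := gaussianTail_strictAnti.injective (Eq.trans hx (Eq.symm hy))
      linarith
    refine hmp.quasiMeasurePreserving.ae
      (p := fun x => gaussianTail (x + μ * ((H i : ℕ) : ℝ)) ≠ s) ?_
    rw [ae_iff]
    simpa using hsub.measure_zero _
  rw [condEMN_eq_map hm H h0 h1] at hP
  exact (ae_map_iff (measurable_emnPValues H ρ μ).aemeasurable hset).1 hP

/-! ### Continuity of the false discovery rate -/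

theorem prior_real_singleton (π₀ : unitInterval) (H : Fin m → Fin 2) :
    (prior m π₀).real {H} = ∏ i, if H i = 0 then (π₀ : ℝ) else 1 - π₀ := by
  rw [prior, measureReal_def, Measure.pi_singleton, ENNReal.toReal_prod]
  refine Finset.prod_congr rfl fun i _ => ?_
  rw [← measureReal_def]
  generalize H i = h
  fin_cases h <;> simp

instance (π₀ : unitInterval) : IsProbabilityMeasure (prior m π₀) := by
  unfold prior; infer_instance

/-- The false discovery rate conditionally on `H`. -/
def condFDR (R : (Fin m → ℝ) → Finset (Fin m)) (H : Fin m → Fin 2) (ρ μ : ℝ) : ℝ :=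
  ∫ x, FDP (R (emnPValues H ρ μ x)) H ∂stdGaussianPi m

theorem FDR_uncondEMN_eq_sum (hm : 0 < m) {t : Fin m → ℝ} {R : (Fin m → ℝ) → Finset (Fin m)}
    (hR : DeterminedByThr t R) (π₀ : unitInterval) {ρ : ℝ} (h0 : 0 ≤ ρ) (h1 : ρ ≤ 1) (μ : ℝ) :
    FDR R (uncondEMN m π₀ ρ μ) =
      ∑ H : Fin m → Fin 2, (∏ i, if H i = 0 then (π₀ : ℝ) else 1 - π₀) * condFDR R H ρ μ := by
  have hmeas : ∀ H : Fin m → Fin 2, Measurable fun p => FDP (R p) H := fun H =>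
    (hR.comp fun S => FDP S H).measurable
  have hmeas2 : Measurable fun x : (Fin m → Fin 2) × (Fin m → ℝ) => FDP (R x.2) x.1 :=
    measurable_from_prod_countable_right hmeas
  have hint : Integrable (fun x : (Fin m → Fin 2) × (Fin m → ℝ) => FDP (R x.2) x.1)
      (prior m π₀ ⊗ₘ condEMNKernel m ρ μ) :=
    Integrable.of_bound hmeas2.aestronglyMeasurable 1 (ae_of_all _ fun x => norm_FDP_le_one _ _)
  rw [FDR, uncondEMN, Measure.integral_compProd hint, integral_fintype .of_finite]
  refine Finset.sum_congr rfl fun H _ => ?_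
  rw [prior_real_singleton, smul_eq_mul]
  congr 1
  change ∫ p, FDP (R p) H ∂condEMN H ρ μ = _
  rw [condEMN_eq_map hm H h0 h1, integral_map (measurable_emnPValues H ρ μ).aemeasurable
    (hmeas H).aestronglyMeasurable, condFDR]

theorem continuousAt_condFDR (hm : 0 < m) {t : Fin m → ℝ} {R : (Fin m → ℝ) → Finset (Fin m)}
    (hR : DeterminedByThr t R) (H : Fin m → Fin 2) {θ : ℝ × ℝ} (h0 : 0 ≤ θ.1) (h1 : θ.1 ≤ 1) :
    ContinuousAt (fun θ : ℝ × ℝ => condFDR R H θ.1 θ.2) θ := by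
  have hR' := hR.comp fun S => FDP S H
  refine continuousAt_of_dominated (bound := fun _ => 1) (Eventually.of_forall fun θ' => ?_)
    (Eventually.of_forall fun θ' => ae_of_all _ fun x => norm_FDP_le_one _ _)
    (integrable_const _) ?_
  · exact (hR'.measurable.comp (measurable_emnPValues H _ _)).aestronglyMeasurable
  · have hae : ∀ᵐ x ∂stdGaussianPi m, ∀ i k, emnPValues H θ.1 θ.2 x i ≠ thr t k :=
      ae_all_iff.2 fun i => ae_all_iff.2 fun k => ae_emnPValues_ne hm H h0 h1 _ _ _
    filter_upwards [hae] with x hx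
    have hc : Continuous fun θ' : ℝ × ℝ => emnPValues H θ'.1 θ'.2 x :=
      (continuous_emnPValues H).comp (by fun_prop : Continuous fun θ' : ℝ × ℝ => (θ'.1, θ'.2, x))
    -- Off the ties, the integrand is constant for parameters near θ.
    exact tendsto_nhds_of_eventually_eq (hc.continuousAt.eventually (hR'.eventuallyEq hx))

theorem DeterminedByThr.continuous_FDR (hm : 0 < m) {t : Fin m → ℝ}
    {R : (Fin m → ℝ) → Finset (Fin m)} (hR : DeterminedByThr t R) {Y : Type*} [TopologicalSpace Y]
    {π₀ ρ : Y → unitInterval} {μ : Y → ℝ} (hπ₀ : Continuous π₀) (hρ : Continuous ρ)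
    (hμ : Continuous μ) : Continuous fun y => FDR R (uncondEMN m (π₀ y) (ρ y) (μ y)) := by
  simp_rw [fun y => FDR_uncondEMN_eq_sum hm hR (π₀ y) (ρ y).2.1 (ρ y).2.2 (μ y)]
  refine continuous_finsetSum _ fun H _ => Continuous.mul ?_ ?_
  · refine continuous_finsetProd _ fun i _ => ?_
    split_ifs <;> fun_prop
  · refine continuous_iff_continuousAt.2 fun y => ?_
    exact ContinuousAt.comp (g := fun θ : ℝ × ℝ => condFDR R H θ.1 θ.2)
      (f := fun y => ((ρ y : ℝ), μ y))
      (continuousAt_condFDR hm hR H (ρ y).2.1 (ρ y).2.2) (by fun_prop)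

/-! ### The linear step-up procedure under independence -/

theorem stepUpIndex_le_card (t p : Fin m → ℝ) : (stepUpIndex t p : ℕ) ≤
    (Finset.univ.filter fun i => p i ≤ thr t (stepUpIndex t p)).card := by
  rw [← ordered_le_thr_iff]
  exact (Finset.mem_filter.1 (Finset.max'_mem
    (Finset.univ.filter fun k : Fin (m + 1) => ordered p k ≤ thr t k) _)).2

theorem le_stepUpIndex {t p : Fin m → ℝ} {k : Fin (m + 1)}
    (h : (k : ℕ) ≤ (Finset.univ.filter fun i => p i ≤ thr t k).card) : k ≤ stepUpIndex t p :=
  Finset.le_max' (Finset.univ.filter fun k : Fin (m + 1) => ordered p k ≤ thr t k) _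
    (Finset.mem_filter.2 ⟨Finset.mem_univ _, (ordered_le_thr_iff t p k).2 h⟩)

theorem IsThreshold.monotone_thr {t : Fin m → ℝ} (ht : IsThreshold t) : Monotone (thr t) := by
  intro a b
  refine Fin.cases (fun _ => ?_) (fun a hab => ?_) a
  · refine Fin.cases le_rfl (fun b => ?_) b
    simpa [thr] using (ht.mem b).1
  · obtain ⟨b, rfl⟩ := Fin.exists_succ_eq.2 (((Fin.succ_pos a).trans_le hab).ne')
    simpa [thr] using ht.mono (Fin.succ_le_succ_iff.1 hab)

theorem IsThreshold.thr_nonneg {t : Fin m → ℝ} (ht : IsThreshold t) (k : Fin (m + 1)) :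
    0 ≤ thr t k := by
  simpa [thr] using ht.monotone_thr (Fin.zero_le k)

/-- Self-consistency: the thresholds being monotone, a rejection count above the step-up index would
itself be an admissible index, contradicting maximality. -/
theorem card_SU {t : Fin m → ℝ} (ht : IsThreshold t) (p : Fin m → ℝ) :
    (SU t p).card = stepUpIndex t p := by
  refine le_antisymm ?_ (stepUpIndex_le_card t p)
  have hlt : (SU t p).card < m + 1 :=
    Nat.lt_succ_of_le ((Finset.card_le_univ _).trans_eq (Fintype.card_fin m))
  have hle : stepUpIndex t p ≤ ⟨(SU t p).card, hlt⟩ := stepUpIndex_le_card t p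
  have : (⟨(SU t p).card, hlt⟩ : Fin (m + 1)) ≤ stepUpIndex t p := by
    refine le_stepUpIndex ?_
    change (SU t p).card ≤ _
    refine Finset.card_le_card fun i hi => ?_
    rw [Finset.mem_filter]
    refine ⟨Finset.mem_univ i, ?_⟩
    replace hi : p i ≤ thr t (stepUpIndex t p) := (Finset.mem_filter.1 hi).2
    exact hi.trans (ht.monotone_thr hle)
  exact this

theorem FDP_SU_zero {t : Fin m → ℝ} (ht : IsThreshold t) (p : Fin m → ℝ) :
    FDP (SU t p) 0 =
      ∑ i, if p i ≤ thr t (stepUpIndex t p) then ((stepUpIndex t p : ℕ) : ℝ)⁻¹ else 0 := by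
  have hcard := card_SU ht p
  rw [← Finset.sum_filter, Finset.sum_const, nsmul_eq_mul]
  change _ = ((SU t p).card : ℝ) * _
  unfold FDP
  simp only [Pi.zero_apply, Finset.filter_true, Finset.univ_inter]
  rw [hcard]
  rcases Nat.eq_zero_or_pos (stepUpIndex t p : ℕ) with h | h
  · simp [h]
  · rw [max_eq_left (by exact_mod_cast h), div_eq_mul_inv]

theorem stepUpIndex_update_pos {t : Fin m → ℝ} (ht : IsThreshold t) (p : Fin m → ℝ) (i : Fin m) :
    0 < (stepUpIndex t (Function.update p i 0) : ℕ) := by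
  have hm : 0 < m := Fin.pos i
  refine lt_of_lt_of_le Nat.one_pos (le_stepUpIndex (k := ⟨1, by omega⟩) ?_)
  exact Finset.card_pos.2 ⟨i, by simpa using ht.thr_nonneg _⟩

theorem stepUpIndex_le_update (t : Fin m → ℝ) {p : Fin m → ℝ} {i : Fin m} (hp : 0 ≤ p i) :
    stepUpIndex t p ≤ stepUpIndex t (Function.update p i 0) := by
  refine le_stepUpIndex ((stepUpIndex_le_card t p).trans (Finset.card_le_card fun j hj => ?_))
  simp only [Finset.mem_filter, Finset.mem_univ, true_and] at hj ⊢
  rcases eq_or_ne j i with rfl | h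
  · simpa using hp.trans hj
  · simpa [h] using hj

/-- At the level reached after the update, `p i` and 0 both count as rejected, so restoring `p i`
does not lower the count there. -/
theorem stepUpIndex_update_eq {t p : Fin m → ℝ} {i : Fin m} (hp : 0 ≤ p i)
    (hi : p i ≤ thr t (stepUpIndex t (Function.update p i 0))) :
    stepUpIndex t (Function.update p i 0) = stepUpIndex t p := by
  refine le_antisymm ?_ (stepUpIndex_le_update t hp)
  refine le_stepUpIndex ((stepUpIndex_le_card t _).trans (Finset.card_le_card fun j hj => ?_))
  simp only [Finset.mem_filter, Finset.mem_univ, true_and] at hj ⊢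
  rcases eq_or_ne j i with rfl | h
  · exact hi
  · simpa [h] using hj

/-- Leave-one-out: the index on the right no longer depends on `p i`, which decouples the i-th
p-value from the number of rejections. -/
theorem ite_stepUpIndex_eq_update {t p : Fin m → ℝ} (ht : IsThreshold t) {i : Fin m}
    (hp : 0 ≤ p i) :
    (if p i ≤ thr t (stepUpIndex t p) then ((stepUpIndex t p : ℕ) : ℝ)⁻¹ else 0) =
      if p i ≤ thr t (stepUpIndex t (Function.update p i 0)) then
        ((stepUpIndex t (Function.update p i 0) : ℕ) : ℝ)⁻¹ else 0 := by
  by_cases hi : p i ≤ thr t (stepUpIndex t (Function.update p i 0))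
  · rw [stepUpIndex_update_eq hp hi]
  · have : ¬ p i ≤ thr t (stepUpIndex t p) := fun h =>
      hi (h.trans (ht.monotone_thr (stepUpIndex_le_update t hp)))
    rw [if_neg hi, if_neg this]

theorem isThreshold_linearThreshold {α : ℝ} (hα : α ∈ Set.Icc (0 : ℝ) 1) :
    IsThreshold (linearThreshold m α) where
  mono a b hab := by
    have : ((a : ℕ) : ℝ) ≤ (b : ℕ) := by exact_mod_cast hab
    have := hα.1
    unfold linearThreshold
    gcongr
  mem k := by
    have hm : (0 : ℝ) < m := by exact_mod_cast Fin.pos k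
    have hk : ((k : ℕ) : ℝ) + 1 ≤ m := by exact_mod_cast k.2
    have hk0 : (0 : ℝ) ≤ ((k : ℕ) : ℝ) + 1 := by positivity
    refine ⟨div_nonneg (mul_nonneg hα.1 hk0) hm.le, ?_⟩
    rw [linearThreshold, div_le_one hm]
    exact (mul_le_of_le_one_left hk0 hα.2).trans hk

theorem IsThreshold.thr_le_one {t : Fin m → ℝ} (ht : IsThreshold t) (k : Fin (m + 1)) :
    thr t k ≤ 1 := by
  refine Fin.cases (by simp [thr]) (fun j => ?_) k
  simpa [thr] using (ht.mem j).2

theorem thr_linearThreshold (α : ℝ) (k : Fin (m + 1)) :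
    thr (linearThreshold m α) k = α * (k : ℕ) / m := by
  refine Fin.cases (by simp [thr]) (fun j => ?_) k
  simp [thr, linearThreshold]

theorem measurable_ite_stepUpIndex (t : Fin m → ℝ) (i : Fin m) : Measurable fun p : Fin m → ℝ =>
    if p i ≤ thr t (stepUpIndex t p) then ((stepUpIndex t p : ℕ) : ℝ)⁻¹ else 0 := by
  refine DeterminedByThr.measurable (t := t) fun p q h => ?_
  simp only [determinedByThr_stepUpIndex t p q h, h]

theorem norm_ite_inv_natCast_le_one (P : Prop) [Decidable P] (k : ℕ) :
    ‖(if P then (k : ℝ)⁻¹ else 0)‖ ≤ 1 := by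
  split_ifs
  · rw [Real.norm_of_nonneg (by positivity)]
    exact Nat.cast_inv_le_one k
  · simp

/-- Under independence, each null hypothesis contributes `α / m` to the false discovery rate of
the linear step-up procedure: conditionally on the other p-values, the rejection of the `i`-th
hypothesis only depends on the comparison of its p-value with a fixed level. -/
theorem integral_ite_stepUpIndex {α : ℝ} (hα : α ∈ Set.Icc (0 : ℝ) 1) (i : Fin m) :
    ∫ x, (if gaussianTail (x i) ≤
          thr (linearThreshold m α) (stepUpIndex (linearThreshold m α) fun j => gaussianTail (x j))
        then ((stepUpIndex (linearThreshold m α) fun j => gaussianTail (x j) : ℕ) : ℝ)⁻¹ else 0)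
      ∂stdGaussianPi m = α / m := by
  obtain ⟨n, rfl⟩ := Nat.exists_eq_succ_of_ne_zero (Fin.pos i).ne'
  have ht := isThreshold_linearThreshold (m := n + 1) hα
  set t := linearThreshold (n + 1) α with ht_def
  let q : ℝ × (Fin n → ℝ) → Fin (n + 1) → ℝ := fun z =>
    i.insertNth (gaussianTail z.1) fun j => gaussianTail (z.2 j)
  have hq : Measurable q := by
    refine measurable_pi_lambda _ fun j => ?_
    refine Fin.succAboveCases i ?_ (fun j => ?_) j
    · simpa [q, Function.comp_def] using measurable_gaussianTail.comp measurable_fst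
    · simpa [q, Function.comp_def] using measurable_gaussianTail.comp 
        ((measurable_pi_apply j).comp measurable_snd)
  let f : ℝ × (Fin n → ℝ) → ℝ := fun z =>
    if q z i ≤ thr t (stepUpIndex t (q z)) then ((stepUpIndex t (q z) : ℕ) : ℝ)⁻¹ else 0
  have hf : Measurable f := (measurable_ite_stepUpIndex t i).comp hq
  have hmp := measurePreserving_piFinSuccAbove (fun _ : Fin (n + 1) => gaussianReal 0 1) i
  have hpull : ∀ x : Fin (n + 1) → ℝ,
      q (MeasurableEquiv.piFinSuccAbove (fun _ => ℝ) i x) = fun j => gaussianTail (x j) := by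
    intro x
    ext j
    refine Fin.succAboveCases i ?_ (fun j => ?_) j
    · simp [q]
    · simp [q, Fin.removeNth]
  have h1 := hmp.integral_comp' f
  -- With the other coordinates frozen, K is a constant and the integral is P(U ≤ αK/m) / K for U
  -- uniform; K cancels because it is positive.
  have h2 : ∀ y : Fin n → ℝ, ∫ a, f (a, y) ∂gaussianReal 0 1 = α / (n + 1 : ℕ) := by
    intro y
    set K := stepUpIndex t (i.insertNth 0 fun j => gaussianTail (y j)) with hK
    have hup : ∀ a, Function.update (q (a, y)) i 0 =
        i.insertNth 0 fun j => gaussianTail (y j) := fun a => by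
      simp [q, Fin.update_insertNth]
    have hKpos : (0 : ℝ) < (K : ℕ) := by
      have := stepUpIndex_update_pos ht (q (0, y)) i
      rw [hup] at this
      exact_mod_cast this
    have hfa : (fun a => f (a, y)) =
        {a | gaussianTail a ≤ thr t K}.indicator fun _ => ((K : ℕ) : ℝ)⁻¹ := by
      ext a
      have hqa : q (a, y) i = gaussianTail a := by simp [q]
      have hpos : 0 ≤ q (a, y) i := by rw [hqa]; exact (gaussianTail_pos a).le
      change (if q (a, y) i ≤ thr t (stepUpIndex t (q (a, y))) then _ else _) = _
      rw [ite_stepUpIndex_eq_update ht hpos, hup, hqa, Set.indicator_apply]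
      rfl
    rw [hfa, integral_indicator_const _
      (measurableSet_le measurable_gaussianTail measurable_const),
      measureReal_gaussianTail_le (ht.thr_nonneg K) (ht.thr_le_one K), ht_def,
      thr_linearThreshold, smul_eq_mul]
    field_simp
  have hint : Integrable f ((gaussianReal 0 1).prod
      (Measure.pi fun _ : Fin n => gaussianReal 0 1)) :=
    Integrable.of_bound hf.aestronglyMeasurable 1 (ae_of_all _ fun z =>
      norm_ite_inv_natCast_le_one _ _)
  rw [integral_prod_symm f hint] at h1
  simp only [h2] at h1
  simp only [f, hpull] at h1
  simpa [stdGaussianPi] using h1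

theorem emnPValues_zero_zero (μ : ℝ) (x : Fin m → ℝ) :
    emnPValues 0 0 μ x = fun i => gaussianTail (x i) := by
  ext i
  simp [emnPValues, equicorrCoeff]

theorem condFDR_LSU_zero (hm : 0 < m) {α : ℝ} (hα : α ∈ Set.Icc (0 : ℝ) 1) (μ : ℝ) :
    condFDR (SU (linearThreshold m α)) 0 0 μ = α := by
  have hm' : (m : ℝ) ≠ 0 := by positivity
  simp only [condFDR, FDP_SU_zero (isThreshold_linearThreshold hα), emnPValues_zero_zero]
  rw [integral_finsetSum]
  · simp only [integral_ite_stepUpIndex hα]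
    simp
    field_simp
  · intro i _
    refine Integrable.of_bound (Measurable.aestronglyMeasurable ?_) 1 (ae_of_all _ fun x =>
      norm_ite_inv_natCast_le_one _ _)
    exact (measurable_ite_stepUpIndex (linearThreshold m α) i).comp
      (measurable_pi_lambda _ fun j => measurable_gaussianTail.comp (measurable_pi_apply j))

theorem FDR_LSU_uncondEMN_one_zero (hm : 0 < m) {α : ℝ} (hα : α ∈ Set.Icc (0 : ℝ) 1) (μ : ℝ) :
    FDR (LSU α) (uncondEMN m 1 0 μ) = α := by
  change FDR (SU (linearThreshold m α)) _ = α
  rw [FDR_uncondEMN_eq_sum hm (determinedByThr_SU _) 1 le_rfl zero_le_one,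
    Finset.sum_eq_single 0]
  · simp [condFDR_LSU_zero hm hα]
  -- At π₀ = 1, any H with a false null carries a zero factor in its weight.
  · intro H _ hH
    obtain ⟨i, hi⟩ := Function.ne_iff.1 hH
    rw [Finset.prod_eq_zero (Finset.mem_univ i) (by simpa using hi), zero_mul]
  · simp

end FDRContinuity

end

theorem corollary3p4 (m : ℕ) (hm : 2 ≤ m) :
    (∀ t : Fin m → ℝ, FDRContinuity.IsThreshold t →
      Continuous (fun θ : unitInterval × unitInterval × Set.Ioi (0 : ℝ) =>
        FDRContinuity.FDR (FDRContinuity.SU t)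
          (FDRContinuity.uncondEMN m θ.1 (θ.2.1 : ℝ) (θ.2.2 : ℝ))) ∧
      Continuous (fun θ : unitInterval × unitInterval × Set.Ioi (0 : ℝ) =>
        FDRContinuity.FDR (FDRContinuity.SD t)
          (FDRContinuity.uncondEMN m θ.1 (θ.2.1 : ℝ) (θ.2.2 : ℝ)))) ∧
    ∀ α ∈ Set.Icc (0 : ℝ) 1, ∀ μ : ℝ, 0 < μ →
      Tendsto (fun ρ : ℝ =>
        FDRContinuity.FDR (FDRContinuity.LSU α) (FDRContinuity.uncondEMN m 1 ρ μ))
        (𝓝[>] 0) (𝓝 α) := by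
  have hm0 : 0 < m := by omega
  refine ⟨fun t _ => ⟨?_, ?_⟩, fun α hα μ _ => ?_⟩
  · exact (FDRContinuity.determinedByThr_SU t).continuous_FDR hm0 continuous_fst
      (continuous_fst.comp continuous_snd)
      (continuous_subtype_val.comp (continuous_snd.comp continuous_snd))
  · exact (FDRContinuity.determinedByThr_SD t).continuous_FDR hm0 continuous_fst
      (continuous_fst.comp continuous_snd)
      (continuous_subtype_val.comp (continuous_snd.comp continuous_snd))
  -- Projecting ρ onto [0, 1] gives a function continuous on all of ℝ that agrees with the original
  -- one on (0, 1].
  · have hlim : Tendsto (fun ρ : ℝ => FDRContinuity.FDR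
        (FDRContinuity.SU (FDRContinuity.linearThreshold m α))
        (FDRContinuity.uncondEMN m 1 (Set.projIcc (0 : ℝ) 1 zero_le_one ρ) μ)) (𝓝 0) (𝓝 α) := by
      refine ((FDRContinuity.determinedByThr_SU
        (FDRContinuity.linearThreshold m α)).continuous_FDR hm0 continuous_const
        continuous_projIcc continuous_const).tendsto' 0 α ?_
      rw [Set.projIcc_left]
      exact FDRContinuity.FDR_LSU_uncondEMN_one_zero hm0 hα μ
    refine (hlim.mono_left nhdsWithin_le_nhds).congr' ?_
    filter_upwards [Ioc_mem_nhdsGT (zero_lt_one (α := ℝ))] with ρ hρ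
    rw [Set.projIcc_of_mem zero_le_one ⟨hρ.1.le, hρ.2⟩]
    rfl
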